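/- Let $\mathbb{T}$ be the unit circle with normalised Lebesgue measure, let $H^2\subset L^2(\mathbb{T})$ be the Hardy space (identified with its boundary values), and let $\theta$ be a non-constant inner function. Let $K_\theta=H^2\ominus\theta H^2$ be the model space, regarded as a subspace of $L^2(\mathbb{T})$, and let $P_\theta$ and $Q_\theta=I-P_\theta$ be the orthogonal projections of $L^2(\mathbb{T})$ onto $K_\theta$ and onto $K_\theta^\perp=L^2(\mathbb{T})\ominus K_\theta=\theta H^2\oplus (H^2)^\perp$. For $\phi\in L^\infty(\mathbb{T})$ let $A_\phi f=P_\theta(\phi f)$ $(f\in K_\theta)$ be the truncated Toeplitz operator and $D_\phi f=Q_\theta(\phi f)$ $(f\in K_\theta^\perp)$ the dual truncated Toeplitz operator with symbol $\phi$. For a bounded operator $T$ on a Hilbert space $\mathcal{H}$, let $\mathcal{E}_T=\{h\in\mathcal{H}:\|Th\|=\|T\|\,\|h\|\}$ be its set of extremal vectors; $T$ is a partial isometry if $\|Th\|=\|h\|$ for all $h\in(\ker T)^\perp$. Let $u,v$ be inner functions such that $\gcd(u,v)=1$ (every common inner divisor of $u$ and $v$ is a unimodular constant) and $v$ divides $\theta$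 (that is, $\theta=vw$ for some inner function $w$). Suppose that $A_{\bar u v}$ is a non-zero partial isometry on $K_\theta$. Put $$\mathcal{E}_+=\{\theta h\in\theta H^2:\|D_{\bar uv}(\theta h)\|=\|\theta h\|\},\qquad \mathcal{E}_-=\{f\in (H^2)^\perp:\|D_{\bar uv}f\|=\|f\|\}.$$ Then $\mathcal{E}_+=\theta uH^2$ and $\mathcal{E}_-=\overline{zvH^2}=\{\overline{zvh}:h\in H^2\}$, and $$\mathcal{E}_{D_{\bar uv}}=\mathcal{E}_+\oplus\mathcal{E}_-\quad\text{if and only if}\quad u\text{ or }v\text{ is a unimodular constant}.$$ -/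

import Mathlib

open MeasureTheory AddCircle
open scoped ENNReal Pointwise

noncomputable section

namespace TTO

/-! ### The circle and its Lebesgue spaces

The unit circle `𝕋` is parametrised by `t ↦ exp (2 π i t)`, `t ∈ ℝ / ℤ`, and carries normalised
Lebesgue measure. The coordinate function `z` is then the monomial `fourier 1`. -/

/-- The unit circle, as `ℝ / ℤ`. -/
abbrev 𝕋 : Type := AddCircle (1 : ℝ)

/-- The normalised Lebesgue measure on the circle. -/
abbrev m : Measure 𝕋 := haarAddCircle

/-- `L²(𝕋)`. -/
abbrev L2 : Type := Lp ℂ 2 m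

/-- `L^∞(𝕋)`. -/
abbrev Linf : Type := Lp ℂ ∞ m

/-- The Laurent operator `M_φ f = φ f` on `L²(𝕋)`. -/
def laurent (φ : Linf) : L2 →L[ℂ] L2 :=
  (ContinuousLinearMap.mul ℂ ℂ).holderL m ∞ 2 2 φ

theorem laurent_coeFn (φ : Linf) (f : L2) : laurent φ f =ᵐ[m] fun t => φ t * f t :=
  ContinuousLinearMap.coeFn_holder _ φ f

/-- The coordinate function `z` on the circle, as an element of `L^∞(𝕋)`. -/
def z : Linf := fourierLp ∞ 1

/-! ### The Hardy space and inner functions -/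

/-- The Hardy space `H²`, as the subspace of `L²(𝕋)` of the functions whose Fourier coefficients
of negative index vanish. -/
def H2 : Submodule ℂ L2 where
  carrier := {f | ∀ n : ℤ, n < 0 → fourierCoeff (f : 𝕋 → ℂ) n = 0}
  zero_mem' := fun n _ => by rw [← fourierBasis_repr]; simp
  add_mem' := fun {f g} hf hg n hn => by
    have h1 := hf n hn
    have h2 := hg n hn
    rw [← fourierBasis_repr] at h1 h2 ⊢
    simp [h1, h2]
  smul_mem' := fun c f hf n hn => by
    have h1 := hf n hn
    rw [← fourierBasis_repr] at h1 ⊢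
    simp [h1]

theorem isClosed_H2 : IsClosed (H2 : Set L2) := by
  have h : (H2 : Set L2) =
      ⋂ n : ℤ, ⋂ _ : n < 0, {f : L2 | inner ℂ (fourierBasis (T := 1) n) f = 0} := by
    ext f
    simp only [Set.mem_iInter, Set.mem_ofPred_eq]
    refine forall_congr' fun n => forall_congr' fun _ => ?_
    rw [← HilbertBasis.repr_apply_apply, fourierBasis_repr]
  rw [h]
  exact isClosed_iInter fun n => isClosed_iInter fun _ =>
    isClosed_eq (continuous_const.inner continuous_id) continuous_const

/-- An inner function, given by its boundary values: a bounded function on the circle which is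
analytic (its Fourier coefficients of negative index vanish) and unimodular almost everywhere. -/
def IsInner (u : Linf) : Prop :=
  (∀ n : ℤ, n < 0 → fourierCoeff (u : 𝕋 → ℂ) n = 0) ∧ ∀ᵐ t ∂m, ‖u t‖ = 1

/-- `u` is (almost everywhere equal to) a constant function. -/
def IsConst (u : Linf) : Prop := ∃ c : ℂ, ∀ᵐ t ∂m, u t = c

/-- `u` is a unimodular constant. -/
def IsUnimodularConst (u : Linf) : Prop := ∃ c : ℂ, ‖c‖ = 1 ∧ ∀ᵐ t ∂m, u t = c

/-- `w` divides `u` in the sense of inner functions: `u = w w'` for some inner `w'`. -/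
def InnerDvd (w u : Linf) : Prop := ∃ w' : Linf, IsInner w' ∧ ∀ᵐ t ∂m, u t = w t * w' t

/-- `gcd(u, v) = 1`: the only common inner divisors of `u` and `v` are unimodular constants. -/
def InnerCoprime (u v : Linf) : Prop :=
  ∀ w : Linf, IsInner w → InnerDvd w u → InnerDvd w v → IsUnimodularConst w

/-! ### Model spaces, truncated and dual truncated Toeplitz operators -/

/-- The subspace `φ H²` of `L²(𝕋)`. -/
def mulH2 (φ : Linf) : Submodule ℂ L2 := H2.map (laurent φ).toLinearMap

/-- The model space `K_θ = H² ⊖ θ H²`. -/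
def modelSpace (θ : Linf) : Submodule ℂ L2 := H2 ⊓ (mulH2 θ)ᗮ

instance (θ : Linf) : CompleteSpace (modelSpace θ) :=
  (isClosed_H2.inter (Submodule.isClosed_orthogonal (mulH2 θ))).completeSpace_coe

/-- The truncated Toeplitz operator `A_φ f = P_θ (φ f)` on `K_θ`. -/
def truncatedToeplitz (θ φ : Linf) : modelSpace θ →L[ℂ] modelSpace θ :=
  (modelSpace θ).orthogonalProjectionOnto ∘L laurent φ ∘L (modelSpace θ).subtypeL

/-- The dual truncated Toeplitz operator `D_φ f = Q_θ (φ f)` on `K_θ^⊥`. -/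
def dualTruncatedToeplitz (θ φ : Linf) : (modelSpace θ)ᗮ →L[ℂ] (modelSpace θ)ᗮ :=
  (modelSpace θ)ᗮ.orthogonalProjectionOnto ∘L laurent φ ∘L (modelSpace θ)ᗮ.subtypeL

/-- The symbol `ū v`. -/
def conjMul (u v : Linf) : Linf := star u • v

/-! ### Partial isometries and extremal vectors -/

/-- `T` is a partial isometry: it is isometric on the orthogonal complement of its null space. -/
def IsPartialIsometry {H : Type*} [NormedAddCommGroup H] [InnerProductSpace ℂ H]
    (T : H →L[ℂ] H) : Prop :=
  ∀ h ∈ (LinearMap.ker T.toLinearMap)ᗮ, ‖T h‖ = ‖h‖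

/-- The set `𝓔_T` of extremal vectors of `T`: those at which `T` attains its norm. -/
def extremalVectors {H : Type*} [NormedAddCommGroup H] [InnerProductSpace ℂ H]
    (T : H →L[ℂ] H) : Set H :=
  {h | ‖T h‖ = ‖T‖ * ‖h‖}

/-- `𝓔₊ = {θ h ∈ θ H² : ‖D_φ (θ h)‖ = ‖θ h‖}`, inside `K_θ^⊥ = θ H² ⊕ (H²)^⊥`. -/
def extremalPlus (θ φ : Linf) : Set (modelSpace θ)ᗮ :=
  {f | (f : L2) ∈ mulH2 θ ∧ ‖dualTruncatedToeplitz θ φ f‖ = ‖f‖}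

/-- `𝓔₋ = {f ∈ (H²)^⊥ : ‖D_φ f‖ = ‖f‖}`, inside `K_θ^⊥ = θ H² ⊕ (H²)^⊥`. -/
def extremalMinus (θ φ : Linf) : Set (modelSpace θ)ᗮ :=
  {f | (f : L2) ∈ H2ᗮ ∧ ‖dualTruncatedToeplitz θ φ f‖ = ‖f‖}

end TTO

end

/-!
Write `φ = ū v`, a unimodular symbol. A vector `x ∈ K_θ^⊥` satisfies `‖D_φ x‖ = ‖x‖` exactly when
`φ x ∈ K_θ^⊥ = θ H² ⊕ (H²)^⊥`, and likewise `‖A_φ x‖ = ‖x‖` exactly when `φ x ∈ K_θ`.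

*The set `𝓔₊`.* A nonzero partial isometry `A_φ` has a vector `x ≠ 0` in `K_θ` with `φ x ∈ K_θ`.
By coprimality `x = u f` with `f ∈ H²`, and `θ̄ u f ⊥ H²` because `x ∈ K_θ`. So the Toeplitz
operator with symbol `θ̄ u` has a nonzero kernel, and by Coburn's lemma (`coburn`) the one with
symbol `ū θ` is injective. If `φ θ h = θ a + b` with `a ∈ H²`, `b ⊥ H²`, then `v h - u a` is in the
kernel of the latter, so `v h = u a`, and coprimality gives `h ∈ u H²`.

*The set `𝓔₋`.* After complex conjugation the same computation leads to the symbol `v̄ θ`, which is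
an inner function because `v` divides `θ`, so that injectivity is immediate.

*The equivalence.* Its two sides are in fact both consequences of the hypotheses. As `A_φ` is a
partial isometry, `φ` maps the component of `φ̄ x` in `K_θ^⊥` back into `K_θ^⊥` for every
`x ∈ K_θ^⊥`. For `x = θ h` that component is `θ P₊(v̄ u h)`, so the description of `𝓔₊` yields
`P₊(v̄ u h) ∈ u H²` for all `h ∈ H²`. This says that the Toeplitz operators with symbols `u` and `v̄`
multiply like their symbols, and comparing Fourier coefficients, as Brown and Halmos do, shows that
`u` or `v` is constant (`isUnimodularConst_or_of_isPartialIsometry`). Then `φ` maps `θ H²` or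
`(H²)^⊥` into `K_θ^⊥`, and the components of an extremal vector are extremal
(`extremalVectors_eq_add`).

The use of coprimality (`InnerCoprime.mem_mulH2`) and the fact that nonzero functions of class `H²`
vanish almost nowhere, on which Coburn's lemma depends, both come from Beurling's theorem
(`exists_isInner_eq_mulH2`).
-/

noncomputable section

namespace TTO

/-! ### Multiplication operators -/

theorem laurent_comm (φ ψ : Linf) (f : L2) :
    laurent φ (laurent ψ f) = laurent ψ (laurent φ f) := by
  apply Lp.ext
  filter_upwards [laurent_coeFn φ (laurent ψ f), laurent_coeFn ψ f, laurent_coeFn ψ (laurent φ f),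
    laurent_coeFn φ f] with t h1 h2 h3 h4
  rw [h1, h2, h3, h4]; ring

theorem conjMul_coeFn (u v : Linf) : conjMul u v =ᵐ[m] fun t => star (u t) * v t := by
  filter_upwards [Lp.coeFn_lpSMul (r := ∞) (star u) v, Lp.coeFn_star u] with t h1 h2
  rw [conjMul, h1, Pi.smul_apply', h2, Pi.star_apply, smul_eq_mul]

theorem laurent_conjMul (u v : Linf) (f : L2) :
    laurent (conjMul u v) f = laurent (star u) (laurent v f) := by
  apply Lp.ext
  filter_upwards [laurent_coeFn (conjMul u v) f, conjMul_coeFn u v, laurent_coeFn v f,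
    laurent_coeFn (star u) (laurent v f), Lp.coeFn_star u] with t h1 h2 h3 h4 h5
  rw [h1, h2, h4, h5, h3, Pi.star_apply]; ring

theorem laurent_star_conjMul (u v : Linf) (f : L2) :
    laurent (star (conjMul u v)) f = laurent u (laurent (star v) f) := by
  apply Lp.ext
  filter_upwards [laurent_coeFn (star (conjMul u v)) f, conjMul_coeFn u v,
    laurent_coeFn (star v) f, laurent_coeFn u (laurent (star v) f), Lp.coeFn_star v,
    Lp.coeFn_star (conjMul u v)] with t h1 h2 h3 h4 h5 h6
  rw [h1, h6, Pi.star_apply, h2, h4, h3, h5, Pi.star_apply, star_mul, star_star]; ring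

theorem star_add_L2 (f g : L2) : star (f + g) = star f + star g := by
  apply Lp.ext
  filter_upwards [Lp.coeFn_star (f + g), Lp.coeFn_add f g, Lp.coeFn_star f, Lp.coeFn_star g,
    Lp.coeFn_add (star f) (star g)] with t h1 h2 h3 h4 h5
  rw [h1, h5, Pi.star_apply, h2, Pi.add_apply, Pi.add_apply, h3, h4, star_add, Pi.star_apply,
    Pi.star_apply]

theorem star_laurent (φ : Linf) (f : L2) : star (laurent φ f) = laurent (star φ) (star f) := by
  apply Lp.ext
  filter_upwards [Lp.coeFn_star (laurent φ f), laurent_coeFn φ f,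
    laurent_coeFn (star φ) (star f), Lp.coeFn_star φ, Lp.coeFn_star f] with t h1 h2 h3 h4 h5
  rw [h1, h3, h4, h5, Pi.star_apply, h2, Pi.star_apply, Pi.star_apply, star_mul, mul_comm]

theorem inner_laurent_left (φ : Linf) (f g : L2) :
    inner ℂ (laurent φ f) g = inner ℂ f (laurent (star φ) g) := by
  rw [L2.inner_def, L2.inner_def]
  refine integral_congr_ae ?_
  filter_upwards [laurent_coeFn φ f, laurent_coeFn (star φ) g, Lp.coeFn_star φ] with t h1 h2 h3
  simp only [h1, h2, h3, RCLike.inner_apply, Pi.star_apply, map_mul, RCLike.star_def]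
  ring

theorem inner_laurent_right (φ : Linf) (f g : L2) :
    inner ℂ f (laurent φ g) = inner ℂ (laurent (star φ) f) g := by
  rw [inner_laurent_left, star_star]

theorem laurent_star_laurent {φ : Linf} (hφ : ∀ᵐ t ∂m, ‖φ t‖ = 1) (f : L2) :
    laurent (star φ) (laurent φ f) = f := by
  apply Lp.ext
  filter_upwards [laurent_coeFn (star φ) (laurent φ f), laurent_coeFn φ f, Lp.coeFn_star φ, hφ]
    with t h1 h2 h3 h4
  rw [h1, h2, h3, Pi.star_apply, ← mul_assoc, RCLike.star_def, RCLike.conj_mul, h4]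
  simp

theorem laurent_laurent_star {φ : Linf} (hφ : ∀ᵐ t ∂m, ‖φ t‖ = 1) (f : L2) :
    laurent φ (laurent (star φ) f) = f := by
  rw [laurent_comm, laurent_star_laurent hφ]

theorem laurent_injective {φ : Linf} (hφ : ∀ᵐ t ∂m, ‖φ t‖ = 1) {f g : L2}
    (h : laurent φ f = laurent φ g) : f = g := by
  rw [← laurent_star_laurent hφ f, h, laurent_star_laurent hφ]

theorem norm_laurent {φ : Linf} (hφ : ∀ᵐ t ∂m, ‖φ t‖ = 1) (f : L2) : ‖laurent φ f‖ = ‖f‖ := by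
  have h : inner ℂ (laurent φ f) (laurent φ f) = inner ℂ f f := by
    rw [inner_laurent_left, laurent_star_laurent hφ]
  rw [@norm_eq_sqrt_re_inner ℂ, h, ← @norm_eq_sqrt_re_inner ℂ]

theorem norm_conjMul {u v : Linf} (hu : ∀ᵐ t ∂m, ‖u t‖ = 1) (hv : ∀ᵐ t ∂m, ‖v t‖ = 1) :
    ∀ᵐ t ∂m, ‖conjMul u v t‖ = 1 := by
  filter_upwards [conjMul_coeFn u v, hu, hv] with t h1 h2 h3
  rw [h1, norm_mul, norm_star, h2, h3, one_mul]

theorem laurent_congr_const {φ : Linf} {c : ℂ} (h : ∀ᵐ t ∂m, φ t = c) (f : L2) :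
    laurent φ f = c • f := by
  apply Lp.ext
  filter_upwards [h, laurent_coeFn φ f, Lp.coeFn_smul c f] with t h1 h2 h3
  rw [h2, h3, h1, Pi.smul_apply, smul_eq_mul]

theorem laurent_star_congr_const {φ : Linf} {c : ℂ} (h : ∀ᵐ t ∂m, φ t = c) (f : L2) :
    laurent (star φ) f = star c • f := by
  apply laurent_congr_const
  filter_upwards [h, Lp.coeFn_star φ] with t h1 h2
  rw [h2, Pi.star_apply, h1]

/-- The constant function `1`, as an element of `L²(𝕋)`. -/
def one2 : L2 := fourierLp 2 0

theorem one2_coeFn : one2 =ᵐ[m] fun _ => (1 : ℂ) := by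
  filter_upwards [coeFn_fourierLp (T := 1) 2 0] with t h
  rw [one2, h, fourier_zero]

theorem laurent_one2_coeFn (φ : Linf) : laurent φ one2 =ᵐ[m] φ := by
  filter_upwards [laurent_coeFn φ one2, one2_coeFn] with t h1 h2
  rw [h1, h2, mul_one]

theorem star_fourierLp (n : ℤ) : star (fourierLp ∞ n : Linf) = fourierLp ∞ (-n) := by
  apply Lp.ext
  filter_upwards [Lp.coeFn_star (fourierLp ∞ n : Linf), coeFn_fourierLp (T := 1) ∞ n,
    coeFn_fourierLp (T := 1) ∞ (-n)] with t h1 h2 h3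
  rw [h1, h3, Pi.star_apply, h2, fourier_neg]; rfl

theorem star_z : star z = fourierLp ∞ (-1) := star_fourierLp 1

theorem laurent_fourierLp (k n : ℤ) :
    laurent (fourierLp ∞ k) (fourierLp 2 n) = fourierLp 2 (k + n) := by
  apply Lp.ext
  filter_upwards [laurent_coeFn (fourierLp ∞ k) (fourierLp 2 n), coeFn_fourierLp (T := 1) ∞ k,
    coeFn_fourierLp (T := 1) 2 n, coeFn_fourierLp (T := 1) 2 (k + n)] with t h1 h2 h3 h4
  rw [h1, h2, h3, h4, fourier_add]

theorem norm_z : ∀ᵐ t ∂m, ‖z t‖ = 1 := by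
  filter_upwards [coeFn_fourierLp (T := 1) ∞ 1] with t h
  rw [z, h, fourier_apply, Circle.norm_coe]

/-! ### Fourier coefficients and the Hardy space -/

/-- The `n`-th Fourier coefficient of a function in `L²(𝕋)`, as a linear functional. -/
def coeff (n : ℤ) : L2 →L[ℂ] ℂ := innerSL ℂ (fourierLp 2 n : L2)

theorem coeff_eq_inner (n : ℤ) (f : L2) : coeff n f = inner ℂ (fourierLp 2 n : L2) f := rfl

theorem coeff_eq_fourierCoeff (n : ℤ) (f : L2) : coeff n f = fourierCoeff (f : 𝕋 → ℂ) n := by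
  rw [coeff_eq_inner, ← fourierBasis_repr, HilbertBasis.repr_apply_apply, coe_fourierBasis]

theorem eq_zero_of_coeff_eq_zero {f : L2} (h : ∀ n, coeff n f = 0) : f = 0 := by
  apply (fourierBasis (T := 1)).repr.injective
  ext n
  rw [fourierBasis_repr, ← coeff_eq_fourierCoeff, h]
  simp

theorem coeff_fourierLp (k n : ℤ) : coeff k (fourierLp 2 n) = if k = n then 1 else 0 :=
  orthonormal_iff_ite.1 orthonormal_fourier k n

theorem coeff_zero_one2 : coeff 0 one2 = 1 := by
  rw [one2, coeff_fourierLp, if_pos rfl]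

theorem one2_ne_zero : one2 ≠ 0 := fun h => by
  have h0 := coeff_zero_one2
  rw [h, map_zero] at h0
  exact zero_ne_one h0

theorem coeff_laurent_z (n : ℤ) (f : L2) : coeff n (laurent z f) = coeff (n - 1) f := by
  rw [coeff_eq_inner, inner_laurent_right, star_z, laurent_fourierLp, coeff_eq_inner,
    neg_add_eq_sub]

theorem coeff_laurent_star_z (n : ℤ) (f : L2) :
    coeff n (laurent (star z) f) = coeff (n + 1) f := by
  have h := coeff_laurent_z (n + 1) (laurent (star z) f)
  rw [laurent_laurent_star norm_z, add_sub_cancel_right] at h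
  exact h.symm

theorem mem_H2_iff {f : L2} : f ∈ H2 ↔ ∀ n < 0, coeff n f = 0 := by
  simp only [coeff_eq_fourierCoeff]; rfl

theorem fourierLp_mem_H2 {n : ℤ} (hn : 0 ≤ n) : (fourierLp 2 n : L2) ∈ H2 := by
  rw [mem_H2_iff]
  intro k hk
  rw [coeff_fourierLp, if_neg (by omega)]

theorem one2_mem_H2 : one2 ∈ H2 := fourierLp_mem_H2 le_rfl

instance : CompleteSpace H2 := isClosed_H2.completeSpace_coe

theorem hasSum_coeff (f : L2) : HasSum (fun n : ℤ => coeff n f • (fourierLp 2 n : L2)) f := by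
  have h := (fourierBasis (T := 1)).hasSum_repr f
  simpa only [coe_fourierBasis, fourierBasis_repr, coeff_eq_fourierCoeff] using h

/-- A closed subspace containing all `T (zⁿ)`, `n ≥ 0`, contains `T f` for every `f ∈ H²`. -/
theorem map_mem_of_mem_H2 {f : L2} (hf : f ∈ H2) (T : L2 →L[ℂ] L2) {N : Submodule ℂ L2}
    (hN : IsClosed (N : Set L2)) (h : ∀ n : ℤ, 0 ≤ n → T (fourierLp 2 n) ∈ N) : T f ∈ N := by
  have hs := (hasSum_coeff f).mapL T
  refine hN.mem_of_tendsto hs (Filter.Eventually.of_forall fun s => ?_)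
  refine N.sum_mem fun n _ => ?_
  rw [map_smul]
  rcases lt_or_ge n 0 with hn | hn
  · rw [mem_H2_iff.1 hf n hn, zero_smul]; exact N.zero_mem
  · exact N.smul_mem _ (h n hn)

theorem mem_H2_orthogonal_iff {f : L2} : f ∈ H2ᗮ ↔ ∀ n, 0 ≤ n → coeff n f = 0 := by
  constructor
  · intro h n hn
    exact Submodule.inner_right_of_mem_orthogonal (fourierLp_mem_H2 hn) h
  · intro h
    rw [Submodule.mem_orthogonal']
    intro g hg
    have := map_mem_of_mem_H2 hg (.id ℂ L2) (N := (ℂ ∙ f)ᗮ) (Submodule.isClosed_orthogonal _)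
      fun n hn => by
        rw [Submodule.mem_orthogonal_singleton_iff_inner_left]
        exact h n hn
    exact Submodule.mem_orthogonal_singleton_iff_inner_right.1 this

theorem laurent_one2_mem_H2_iff {φ : Linf} :
    laurent φ one2 ∈ H2 ↔ ∀ n : ℤ, n < 0 → fourierCoeff (φ : 𝕋 → ℂ) n = 0 := by
  rw [mem_H2_iff]
  refine forall_congr' fun n => forall_congr' fun _ => ?_
  rw [coeff_eq_fourierCoeff, fourierCoeff_congr_ae (laurent_one2_coeFn φ)]

theorem laurent_z_mem_H2 {f : L2} (hf : f ∈ H2) : laurent z f ∈ H2 := by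
  rw [mem_H2_iff] at hf ⊢
  intro n hn
  rw [coeff_laurent_z, hf _ (by omega)]

theorem laurent_z_fourierLp (n : ℤ) : laurent z (fourierLp 2 n) = fourierLp 2 (n + 1) := by
  rw [z, laurent_fourierLp, add_comm]

theorem map_fourierLp_mem (φ : Linf) {N : Submodule ℂ L2} (hz : ∀ f ∈ N, laurent z f ∈ N)
    (h1 : laurent φ one2 ∈ N) (n : ℤ) (hn : 0 ≤ n) : laurent φ (fourierLp 2 n) ∈ N := by
  induction n, hn using Int.leInduction with
  | base => exact h1
  | succ n hn ih =>
    rw [← laurent_z_fourierLp, laurent_comm]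
    exact hz _ ih

/-- `φ H² ⊆ N` for a closed subspace `N` stable under multiplication by `z` and containing `φ`. -/
theorem laurent_mem_of_invariant {φ : Linf} {N : Submodule ℂ L2} (hN : IsClosed (N : Set L2))
    (hz : ∀ f ∈ N, laurent z f ∈ N) (h1 : laurent φ one2 ∈ N) {f : L2} (hf : f ∈ H2) :
    laurent φ f ∈ N :=
  map_mem_of_mem_H2 hf (laurent φ) hN (map_fourierLp_mem φ hz h1)

theorem IsInner.laurent_mem_H2 {u : Linf} (hu : IsInner u) {f : L2} (hf : f ∈ H2) :
    laurent u f ∈ H2 :=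
  laurent_mem_of_invariant isClosed_H2 (fun _ => laurent_z_mem_H2)
    (laurent_one2_mem_H2_iff.2 hu.1) hf

theorem IsInner.laurent_star_mem_orthogonal {u : Linf} (hu : IsInner u) {f : L2} (hf : f ∈ H2ᗮ) :
    laurent (star u) f ∈ H2ᗮ := by
  rw [Submodule.mem_orthogonal] at hf ⊢
  intro g hg
  rw [inner_laurent_right, star_star]
  exact hf _ (hu.laurent_mem_H2 hg)

theorem eq_zero_of_mem_of_mem_orthogonal {N : Submodule ℂ L2} {f : L2} (h : f ∈ N) (h' : f ∈ Nᗮ) :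
    f = 0 :=
  inner_self_eq_zero.1 (Submodule.inner_right_of_mem_orthogonal h h')

theorem exists_add_of_H2 (f : L2) : ∃ g ∈ H2, ∃ q ∈ H2ᗮ, f = g + q :=
  ⟨_, H2.starProjection_apply_mem f, _, H2.sub_starProjection_mem_orthogonal f, by abel⟩

theorem coeff_star (n : ℤ) (f : L2) : coeff n (star f) = star (coeff (-n) f) := by
  rw [coeff_eq_inner, coeff_eq_inner, L2.inner_def, L2.inner_def, RCLike.star_def,
    ← integral_conj]
  refine integral_congr_ae ?_
  filter_upwards [Lp.coeFn_star f, coeFn_fourierLp (T := 1) 2 n, coeFn_fourierLp (T := 1) 2 (-n)]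
    with t h1 h2 h3
  simp only [h1, h2, h3, RCLike.inner_apply, Pi.star_apply, map_mul, RCLike.star_def, fourier_neg,
    Complex.conj_conj]

/-- `(H²)^⊥` consists of the complex conjugates of the functions in `z H²`. -/
theorem mem_H2_orthogonal_iff_exists {f : L2} :
    f ∈ H2ᗮ ↔ ∃ h ∈ H2, f = star (laurent z h) := by
  rw [mem_H2_orthogonal_iff]
  constructor
  · intro hf
    refine ⟨laurent (star z) (star f), ?_, by rw [laurent_laurent_star norm_z, star_star]⟩
    rw [mem_H2_iff]
    intro n hn
    rw [coeff_laurent_star_z, coeff_star, hf _ (by omega), star_zero]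
  · rintro ⟨h, hh, rfl⟩ n hn
    rw [coeff_star, coeff_laurent_z, mem_H2_iff.1 hh _ (by omega), star_zero]

/-- A unimodular function of class `H²` is inner. -/
theorem exists_isInner_of_mem_H2 {f : L2} (hf : f ∈ H2) (h1 : ∀ᵐ t ∂m, ‖f t‖ = 1) :
    ∃ φ : Linf, IsInner φ ∧ φ =ᵐ[m] f ∧ laurent φ one2 = f := by
  have hb : MemLp f ∞ m := memLp_top_of_bound (Lp.aestronglyMeasurable f) 1
    (h1.mono fun _ => le_of_eq)
  have h2 : laurent (hb.toLp f) one2 = f :=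
    Lp.ext ((laurent_one2_coeFn _).trans hb.coeFn_toLp)
  refine ⟨hb.toLp f, ⟨?_, ?_⟩, hb.coeFn_toLp, h2⟩
  · rw [← laurent_one2_mem_H2_iff, h2]; exact hf
  · filter_upwards [hb.coeFn_toLp, h1] with t h3 h4
    rw [h3, h4]

/-! ### Uniqueness of Fourier coefficients in `L¹` -/

theorem integral_mul_eq_zero_of_fourierCoeff_eq_zero {g : 𝕋 → ℂ} (hg : Integrable g m)
    (h : ∀ n, fourierCoeff g n = 0) (F : C(𝕋, ℂ)) : ∫ t, F t * g t ∂m = 0 := by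
  have hint : ∀ F : C(𝕋, ℂ), Integrable (fun t => F t * g t) m := fun F =>
    hg.bdd_mul F.continuous.aestronglyMeasurable (Filter.Eventually.of_forall F.norm_coe_le_norm)
  let Λ₀ : C(𝕋, ℂ) →ₗ[ℂ] ℂ :=
    { toFun := fun F => ∫ t, F t * g t ∂m
      map_add' := fun F G => by
        rw [← integral_add (hint F) (hint G)]
        simp only [ContinuousMap.add_apply, add_mul]
      map_smul' := fun c F => by
        simp only [ContinuousMap.smul_apply, smul_eq_mul, mul_assoc, RingHom.id_apply,
          integral_const_mul] }
  let Λ : C(𝕋, ℂ) →L[ℂ] ℂ := Λ₀.mkContinuous (∫ t, ‖g t‖ ∂m) fun F => by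
    calc ‖∫ t, F t * g t ∂m‖ ≤ ∫ t, ‖F‖ * ‖g t‖ ∂m := by
          refine norm_integral_le_of_norm_le (hg.norm.const_mul _)
            (Filter.Eventually.of_forall fun t => ?_)
          rw [norm_mul]
          exact mul_le_mul_of_nonneg_right (F.norm_coe_le_norm t) (norm_nonneg _)
      _ = _ := by rw [integral_const_mul, mul_comm]
  have hle : (Submodule.span ℂ (Set.range (fourier (T := 1)))).topologicalClosure ≤
      LinearMap.ker Λ.toLinearMap := by
    refine Submodule.topologicalClosure_minimal _ ?_ Λ.isClosed_ker
    rw [Submodule.span_le]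
    rintro _ ⟨n, rfl⟩
    have h1 := h (-n)
    rw [fourierCoeff, neg_neg] at h1
    exact h1
  rw [span_fourier_closure_eq_top] at hle
  exact hle (Submodule.mem_top : F ∈ ⊤)

/-- The finite measures with densities `r⁺` and `r⁻` integrate continuous functions alike, so they
coincide. -/
theorem ae_eq_zero_of_integral_continuous_mul_eq_zero {r : 𝕋 → ℝ} (hr : Integrable r m)
    (h : ∀ f : C(𝕋, ℝ), ∫ t, f t * r t ∂m = 0) : r =ᵐ[m] 0 := by
  have hfin : ∀ s : 𝕋 → ℝ, Integrable s m →
      IsFiniteMeasure (m.withDensity fun t => ENNReal.ofReal (s t)) := fun s hs =>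
    isFiniteMeasure_withDensity_ofReal hs.2
  have := hfin r hr
  have := hfin (fun t => -r t) hr.neg
  have hm : ∀ s : 𝕋 → ℝ, Integrable s m → AEMeasurable (fun t => ENNReal.ofReal (s t)) m :=
    fun s hs => hs.1.aemeasurable.ennreal_ofReal
  have key : m.withDensity (fun t => ENNReal.ofReal (r t)) =
      m.withDensity fun t => ENNReal.ofReal (-r t) := by
    refine ext_of_forall_integral_eq_of_IsFiniteMeasure fun f => ?_
    rw [integral_withDensity_eq_integral_toReal_smul₀ (hm r hr) (by simp),
      integral_withDensity_eq_integral_toReal_smul₀ (hm (fun t => -r t) hr.neg) (by simp),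
      ← sub_eq_zero]
    have hint : ∀ s : 𝕋 → ℝ, Integrable s m →
        Integrable (fun t => (ENNReal.ofReal (s t)).toReal • f t) m := fun s hs => by
      have : Integrable (fun t => max (s t) 0) m := hs.pos_part
      simp only [ENNReal.toReal_ofReal', smul_eq_mul]
      exact this.mul_bdd f.continuous.aestronglyMeasurable
        (Filter.Eventually.of_forall f.norm_coe_le_norm)
    rw [← integral_sub (hint r hr) (hint (fun t => -r t) hr.neg), ← h f.toContinuousMap]
    refine integral_congr_ae (Filter.Eventually.of_forall fun t => ?_)
    have : max (r t) 0 - max (-r t) 0 = r t := max_zero_sub_max_neg_zero_eq_self _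
    simp only [ENNReal.toReal_ofReal', smul_eq_mul]
    rw [← sub_mul, this, mul_comm]; rfl
  have hne : ∫⁻ t, ENNReal.ofReal (r t) ∂m ≠ ∞ := hr.lintegral_lt_top.ne
  filter_upwards [(withDensity_eq_iff (hm r hr) (hm (fun t => -r t) hr.neg) hne).1 key] with t ht
  have h1 := congrArg ENNReal.toReal ht
  rw [ENNReal.toReal_ofReal', ENNReal.toReal_ofReal'] at h1
  have : max (r t) 0 - max (-r t) 0 = r t := max_zero_sub_max_neg_zero_eq_self _
  rw [Pi.zero_apply, ← this, h1, sub_self]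

/-- An integrable function on the circle is determined by its Fourier coefficients. -/
theorem ae_eq_zero_of_fourierCoeff_eq_zero {g : 𝕋 → ℂ} (hg : Integrable g m)
    (h : ∀ n, fourierCoeff g n = 0) : g =ᵐ[m] 0 := by
  have hF : ∀ f : C(𝕋, ℝ), ∫ t, (f t : ℂ) * g t ∂m = 0 := fun f =>
    integral_mul_eq_zero_of_fourierCoeff_eq_zero hg h
      ⟨fun t => (f t : ℂ), Complex.continuous_ofReal.comp f.continuous⟩
  have hint : ∀ f : C(𝕋, ℝ), Integrable (fun t => (f t : ℂ) * g t) m := fun f =>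
    hg.bdd_mul (Complex.continuous_ofReal.comp f.continuous).aestronglyMeasurable
      (Filter.Eventually.of_forall fun t => by
        rw [Complex.norm_real]; exact f.norm_coe_le_norm t)
  have hre := ae_eq_zero_of_integral_continuous_mul_eq_zero hg.re fun f => by
    have := integral_re (hint f)
    rw [hF f] at this
    simpa using this
  have him := ae_eq_zero_of_integral_continuous_mul_eq_zero hg.im fun f => by
    have := integral_im (hint f)
    rw [hF f] at this
    simpa using this
  filter_upwards [hre, him] with t h1 h2
  exact Complex.ext h1 h2

theorem integrable_mul_star (f g : L2) : Integrable (fun t => f t * star (g t)) m := by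
  refine (L2.integrable_inner (𝕜 := ℂ) g f).congr (Filter.Eventually.of_forall fun t => ?_)
  simp [RCLike.inner_apply]

theorem fourierCoeff_mul_star (f g : L2) (n : ℤ) :
    fourierCoeff (fun t => f t * star (g t)) n =
      inner ℂ (laurent (fourierLp ∞ n) g) f := by
  rw [fourierCoeff, L2.inner_def]
  refine integral_congr_ae ?_
  filter_upwards [laurent_coeFn (fourierLp ∞ n) g, coeFn_fourierLp (T := 1) ∞ n] with t h1 h2
  simp only [h1, h2, RCLike.inner_apply, map_mul, fourier_neg, smul_eq_mul, RCLike.star_def]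
  ring

theorem laurent_fourierLp_succ (n : ℤ) (f : L2) :
    laurent (fourierLp ∞ (n + 1)) f = laurent z (laurent (fourierLp ∞ n) f) := by
  apply Lp.ext
  filter_upwards [laurent_coeFn (fourierLp ∞ (n + 1)) f, coeFn_fourierLp (T := 1) ∞ n,
    laurent_coeFn z (laurent (fourierLp ∞ n) f), laurent_coeFn (fourierLp ∞ n) f,
    coeFn_fourierLp (T := 1) ∞ 1, coeFn_fourierLp (T := 1) ∞ (n + 1)] with t h1 h2 h3 h4 h5 h6
  rw [h1, h3, h4, h6, h2, z, h5, fourier_add]; ring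

theorem laurent_fourierLp_zero (f : L2) : laurent (fourierLp ∞ 0) f = f := by
  rw [laurent_congr_const (c := 1), one_smul]
  filter_upwards [coeFn_fourierLp (T := 1) ∞ 0] with t h
  rw [h, fourier_zero]

theorem laurent_fourierLp_mem {N : Submodule ℂ L2} (hz : ∀ f ∈ N, laurent z f ∈ N) {f : L2}
    (hf : f ∈ N) {n : ℤ} (hn : 0 ≤ n) : laurent (fourierLp ∞ n) f ∈ N := by
  induction n, hn using Int.leInduction with
  | base => rwa [laurent_fourierLp_zero]
  | succ n hn ih => rw [laurent_fourierLp_succ]; exact hz _ ih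

theorem laurent_fourierLp_mem_H2 {f : L2} (hf : f ∈ H2) {n : ℤ} (hn : 0 ≤ n) :
    laurent (fourierLp ∞ n) f ∈ H2 :=
  laurent_fourierLp_mem (fun _ => laurent_z_mem_H2) hf hn

/-! ### Beurling's theorem -/

/-- A nonzero closed shift-invariant subspace `N` of `H²` contains a nonzero vector orthogonal
to `z N`: otherwise `N = z N`, and then `N ⊆ ⋂ zⁿ H² = 0`. -/
theorem exists_wandering_vector {N : Submodule ℂ L2} (hN : IsClosed (N : Set L2)) (hle : N ≤ H2)
    (hz : ∀ f ∈ N, laurent z f ∈ N) (hne : N ≠ ⊥) :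
    ∃ f ∈ N, f ≠ 0 ∧ ∀ g ∈ N, inner ℂ f (laurent z g) = 0 := by
  by_contra! hcon
  let M : Submodule ℂ L2 := N.comap (laurent (star z)).toLinearMap
  have hM : ∀ f, f ∈ M ↔ laurent (star z) f ∈ N := fun f => Submodule.mem_comap
  have hMcl : IsClosed (M : Set L2) := hN.preimage (laurent (star z)).continuous
  clear_value M
  have hMN : M ≤ N := fun f hf => by
    have h := hz _ ((hM f).1 hf)
    rwa [laurent_laurent_star norm_z] at h
  have : CompleteSpace M := hMcl.completeSpace_coe
  have hNM : ∀ f ∈ N, laurent (star z) f ∈ N := fun f hf => by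
    rw [← hM]
    have hq : f - M.starProjection f ∈ N := N.sub_mem hf (hMN (M.starProjection_apply_mem f))
    have hq0 : f - M.starProjection f = 0 := by
      by_contra h0
      obtain ⟨g, hg, hg'⟩ := hcon _ hq h0
      refine hg' (Submodule.inner_left_of_mem_orthogonal (K := M) ?_
        (M.sub_starProjection_mem_orthogonal f))
      rwa [hM, laurent_star_laurent norm_z]
    rw [sub_eq_zero.1 hq0]
    exact M.starProjection_apply_mem f
  have hc : ∀ k : ℕ, ∀ f ∈ N, coeff ((k : ℤ) - 1) f = 0 := by
    intro k
    induction k with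
    | zero => exact fun f hf => mem_H2_iff.1 (hle hf) _ (by simp)
    | succ k ih =>
      intro f hf
      have h := ih _ (hNM f hf)
      rw [coeff_laurent_star_z] at h
      rwa [Nat.cast_succ, add_sub_cancel_right, ← sub_add_cancel (k : ℤ) 1]
  refine hne ((Submodule.eq_bot_iff _).2 fun f hf => eq_zero_of_coeff_eq_zero fun n => ?_)
  rcases lt_or_ge n 0 with hn | hn
  · exact mem_H2_iff.1 (hle hf) n hn
  · have := hc (n + 1).toNat f hf
    rwa [Int.toNat_of_nonneg (by omega), add_sub_cancel_right] at this

/-- **Beurling's theorem**: a nonzero closed shift-invariant subspace of `H²` is `w H²` for some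
inner function `w`. For a unit vector `f ∈ N` orthogonal to `z N`, the Fourier coefficients
of `|f|²` with nonzero index vanish, so `f` is unimodular, and `w = f` will do. -/
theorem exists_isInner_eq_mulH2 {N : Submodule ℂ L2} (hN : IsClosed (N : Set L2)) (hle : N ≤ H2)
    (hz : ∀ f ∈ N, laurent z f ∈ N) (hne : N ≠ ⊥) :
    ∃ w : Linf, IsInner w ∧ N = mulH2 w := by
  obtain ⟨f₀, hf₀, hf₀0, hort₀⟩ := exists_wandering_vector hN hle hz hne
  obtain ⟨f, hf, hf1, hort⟩ : ∃ f ∈ N, ‖f‖ = 1 ∧ ∀ g ∈ N, inner ℂ f (laurent z g) = 0 := by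
    refine ⟨((‖f₀‖⁻¹ : ℝ) : ℂ) • f₀, N.smul_mem _ hf₀, ?_, fun g hg => ?_⟩
    · rw [norm_smul, Complex.norm_real, norm_inv, norm_norm,
        inv_mul_cancel₀ (norm_ne_zero_iff.2 hf₀0)]
    · rw [inner_smul_left, hort₀ g hg, mul_zero]
  have hpos : ∀ n : ℤ, 0 < n → ∀ g ∈ N, inner ℂ f (laurent (fourierLp ∞ n) g) = 0 := by
    intro n hn g hg
    obtain ⟨k, rfl⟩ : ∃ k, n = k + 1 := ⟨n - 1, by ring⟩
    rw [laurent_fourierLp_succ]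
    exact hort _ (laurent_fourierLp_mem hz hg (by omega))
  -- `|f|² - 1` is integrable and all its Fourier coefficients vanish
  have hcoeff : ∀ n, fourierCoeff (fun t => f t * star (f t) - one2 t * star (one2 t)) n = 0 := by
    intro n
    have hsub : fourierCoeff (fun t => f t * star (f t) - one2 t * star (one2 t)) n =
        inner ℂ (laurent (fourierLp ∞ n) f) f - inner ℂ (laurent (fourierLp ∞ n) one2) one2 := by
      rw [← fourierCoeff_mul_star, ← fourierCoeff_mul_star]
      simp only [fourierCoeff, smul_sub]
      exact integral_sub ((integrable_mul_star f f).fourier_smul _)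
        ((integrable_mul_star one2 one2).fourier_smul _)
    have hone : inner ℂ (laurent (fourierLp ∞ n) one2) one2 = if n = 0 then (1 : ℂ) else 0 := by
      rw [one2, laurent_fourierLp, add_zero, ← coeff_eq_inner, coeff_fourierLp]
    rw [hsub, hone]
    rcases lt_trichotomy n 0 with hn | rfl | hn
    · rw [inner_laurent_left, star_fourierLp, hpos (-n) (by omega) f hf, if_neg hn.ne, sub_zero]
    · rw [laurent_fourierLp_zero, inner_self_eq_norm_sq_to_K, hf1]; simp
    · rw [← inner_conj_symm, hpos n hn f hf, if_neg hn.ne', map_zero, sub_zero]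
  have hzero := ae_eq_zero_of_fourierCoeff_eq_zero
    ((integrable_mul_star f f).sub (integrable_mul_star one2 one2)) hcoeff
  have huni : ∀ᵐ t ∂m, ‖f t‖ = 1 := by
    filter_upwards [hzero, one2_coeFn] with t h1 h2
    have h3 : f t * star (f t) = 1 := by
      simp only [Pi.zero_apply, Pi.sub_apply, h2, star_one, mul_one] at h1
      exact sub_eq_zero.1 h1
    rw [RCLike.star_def, RCLike.mul_conj] at h3
    have h4 : ‖f t‖ ^ 2 = 1 := Complex.ofReal_injective (by rw [Complex.ofReal_pow]; exact h3)
    exact (pow_eq_one_iff_of_nonneg (norm_nonneg _) two_ne_zero).1 h4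
  obtain ⟨w, hw, -, hwf⟩ := exists_isInner_of_mem_H2 (hle hf) huni
  refine ⟨w, hw, le_antisymm (fun g hg => ?_) ?_⟩
  · refine ⟨laurent (star w) g, ?_, laurent_laurent_star hw.2 g⟩
    refine mem_H2_iff.2 fun n hn => ?_
    have h1 : (fourierLp 2 n : L2) = laurent (fourierLp ∞ n) one2 := by
      rw [one2, laurent_fourierLp, add_zero]
    rw [coeff_eq_inner, inner_laurent_right, star_star, h1, laurent_comm, hwf, inner_laurent_left,
      star_fourierLp]
    exact hpos (-n) (by omega) g hg
  · rintro _ ⟨g, hg, rfl⟩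
    exact laurent_mem_of_invariant hN hz (hwf.symm ▸ hf) hg

/-! ### Consequences of Beurling's theorem -/

/-- A nonzero function of class `H²` vanishes almost nowhere: the functions of class `H²` that
vanish on a given set form a shift-invariant subspace, which contains a unimodular function unless
it is zero. -/
theorem eq_zero_or_eq_zero_of_mul_eq_zero {f k : L2} (hf : f ∈ H2)
    (h : ∀ᵐ t ∂m, f t * k t = 0) : f = 0 ∨ k = 0 := by
  by_contra! hcon
  let s : Set 𝕋 := {t | k t ≠ 0}
  have hs : MeasurableSet s :=
    (Lp.stronglyMeasurable k).measurable (measurableSet_singleton (0 : ℂ)).compl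
  let χ : Linf := indicatorConstLp ∞ hs (measure_ne_top m s) (1 : ℂ)
  have hχ : χ =ᵐ[m] s.indicator fun _ => (1 : ℂ) := indicatorConstLp_coeFn
  -- the functions of class `H²` vanishing wherever `k` does not
  let N : Submodule ℂ L2 := H2 ⊓ LinearMap.ker (laurent χ).toLinearMap
  have hNcl : IsClosed (N : Set L2) := isClosed_H2.inter (laurent χ).isClosed_ker
  have hfN : f ∈ N := by
    refine ⟨hf, ?_⟩
    change laurent χ f = 0
    apply Lp.ext
    filter_upwards [laurent_coeFn χ f, hχ, h, Lp.coeFn_zero ℂ 2 m] with t h1 h2 h3 h4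
    rw [h1, h2, h4]
    by_cases ht : t ∈ s
    · rw [Set.indicator_of_mem ht, (mul_eq_zero.1 h3).resolve_right ht]; simp
    · rw [Set.indicator_of_notMem ht, zero_mul]; rfl
  have hz : ∀ g ∈ N, laurent z g ∈ N := fun g hg => by
    refine ⟨laurent_z_mem_H2 hg.1, ?_⟩
    change laurent χ (laurent z g) = 0
    rw [laurent_comm, show laurent χ g = 0 from hg.2, map_zero]
  obtain ⟨w, hw, hNw⟩ := exists_isInner_eq_mulH2 hNcl inf_le_left hz
    (Submodule.ne_bot_iff _ |>.2 ⟨f, hfN, hcon.1⟩)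
  have hwN : laurent w one2 ∈ N := by rw [hNw]; exact ⟨one2, one2_mem_H2, rfl⟩
  apply hcon.2
  apply Lp.ext
  have h0 : laurent χ (laurent w one2) = 0 := hwN.2
  filter_upwards [laurent_coeFn χ (laurent w one2), hχ, laurent_one2_coeFn w, hw.2,
    Lp.coeFn_zero ℂ 2 m] with t h1 h2 h3 h4 h5
  rw [h0, h5, h2, h3] at h1
  rw [h5]
  by_contra ht
  rw [Set.indicator_of_mem (show t ∈ s from ht), one_mul] at h1
  rw [← h1] at h4
  simp at h4

/-- **Coburn's lemma** for a unimodular symbol `σ`: the Toeplitz operators with symbols `σ` and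
`σ̄` cannot both have a nonzero kernel. If `k` and `f` are in these kernels, then the integrable
function `σ k f̄` has no Fourier coefficients at all. -/
theorem coburn {σ : Linf} (hσ : ∀ᵐ t ∂m, ‖σ t‖ = 1) {k f : L2} (hk : k ∈ H2) (hf : f ∈ H2)
    (hσk : laurent σ k ∈ H2ᗮ) (hσf : laurent (star σ) f ∈ H2ᗮ) : k = 0 ∨ f = 0 := by
  refine eq_zero_or_eq_zero_of_mul_eq_zero hk ?_
  have hcoeff : ∀ n, fourierCoeff (fun t => laurent σ k t * star (f t)) n = 0 := by
    intro n
    rw [fourierCoeff_mul_star]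
    rcases le_total 0 n with hn | hn
    · exact Submodule.inner_right_of_mem_orthogonal (laurent_fourierLp_mem_H2 hf hn) hσk
    · rw [inner_laurent_right, laurent_comm, inner_laurent_left, star_fourierLp]
      exact Submodule.inner_left_of_mem_orthogonal
        (laurent_fourierLp_mem_H2 hk (by omega)) hσf
  filter_upwards [ae_eq_zero_of_fourierCoeff_eq_zero (integrable_mul_star _ _) hcoeff, hσ,
    laurent_coeFn σ k] with t h1 h2 h3
  have h4 : σ t ≠ 0 := fun h => by simp [h] at h2
  rw [h3, Pi.zero_apply, mul_assoc] at h1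
  rcases mul_eq_zero.1 ((mul_eq_zero.1 h1).resolve_left h4) with h5 | h5
  · rw [h5, zero_mul]
  · rw [star_eq_zero.1 h5, mul_zero]

/-- If `u` and `v` are coprime inner functions and `u` divides `v h` in `H²`, then `u` divides `h`.
The functions `h` for which `v h ∈ u H²` form a space `w H²` by Beurling's theorem, and `u / w` is
a common inner divisor of `u` and `v`. -/
theorem InnerCoprime.mem_mulH2 {u v : Linf} (huv : InnerCoprime u v) (hu : IsInner u)
    (hv : IsInner v) {h g : L2} (hh : h ∈ H2) (hg : g ∈ H2) (heq : laurent v h = laurent u g) :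
    ∃ k ∈ H2, h = laurent u k := by
  let N : Submodule ℂ L2 := H2 ⊓ H2.comap ((laurent (star u)) ∘L (laurent v)).toLinearMap
  have hNcl : IsClosed (N : Set L2) := isClosed_H2.inter
    (isClosed_H2.preimage ((laurent (star u)) ∘L (laurent v)).continuous)
  have hN : ∀ {f}, f ∈ N ↔ f ∈ H2 ∧ laurent (star u) (laurent v f) ∈ H2 := Iff.rfl
  have hz : ∀ f ∈ N, laurent z f ∈ N := fun f hf => by
    refine hN.2 ⟨laurent_z_mem_H2 hf.1, ?_⟩
    rw [laurent_comm v z, laurent_comm (star u) z]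
    exact laurent_z_mem_H2 (hN.1 hf).2
  have huN : laurent u one2 ∈ N := by
    refine hN.2 ⟨hu.laurent_mem_H2 one2_mem_H2, ?_⟩
    rw [laurent_comm v u, laurent_star_laurent hu.2]
    exact hv.laurent_mem_H2 one2_mem_H2
  have hne : N ≠ ⊥ := by
    refine (Submodule.ne_bot_iff _).2 ⟨_, huN, fun h0 => ?_⟩
    exact one2_ne_zero (laurent_injective hu.2 (by rw [h0, map_zero]))
  obtain ⟨w, hw, hNw⟩ := exists_isInner_eq_mulH2 hNcl inf_le_left hz hne
  -- `u = w u'`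
  obtain ⟨f, hf, hfu⟩ : laurent u one2 ∈ mulH2 w := hNw ▸ huN
  change laurent w f = laurent u one2 at hfu
  have hfu' : ∀ᵐ t ∂m, u t = w t * f t := by
    filter_upwards [laurent_coeFn w f, laurent_one2_coeFn u] with t h1 h2
    rw [← h2, ← hfu, h1]
  obtain ⟨u', hu', hu'f, -⟩ := exists_isInner_of_mem_H2 hf (by
    filter_upwards [hfu', hu.2, hw.2] with t h1 h2 h3
    rwa [h1, norm_mul, h3, one_mul] at h2)
  -- `v = u' v'`, where `v' = ū v w`
  have hwN : laurent w one2 ∈ N := by rw [hNw]; exact ⟨one2, one2_mem_H2, rfl⟩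
  have hv'c : ∀ᵐ t ∂m, laurent (star u) (laurent v (laurent w one2)) t =
      star (u t) * (v t * w t) := by
    filter_upwards [laurent_coeFn (star u) (laurent v (laurent w one2)), Lp.coeFn_star u,
      laurent_coeFn v (laurent w one2), laurent_one2_coeFn w] with t h1 h2 h3 h4
    rw [h1, h2, Pi.star_apply, h3, h4]
  obtain ⟨v', hv', hv'f, -⟩ := exists_isInner_of_mem_H2 (hN.1 hwN).2 (by
    filter_upwards [hv'c, hu.2, hv.2, hw.2] with t h1 h2 h3 h4
    rw [h1, norm_mul, norm_mul, norm_star, h2, h3, h4]; norm_num)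
  obtain ⟨c, hc, hu'c⟩ := huv u' hu'
    ⟨w, hw, by filter_upwards [hfu', hu'f] with t h1 h2; rw [h1, h2, mul_comm]⟩
    ⟨v', hv', by
      filter_upwards [hfu', hu'f, hv'f, hv'c, hu.2] with t h1 h2 h3 h4 h5
      have h6 : u t * star (u t) = 1 := by rw [RCLike.star_def, RCLike.mul_conj, h5]; simp
      calc v t = (u t * star (u t)) * v t := by rw [h6, one_mul]
        _ = u' t * (star (u t) * (v t * w t)) := by rw [h2]; nth_rewrite 1 [h1]; ring
        _ = u' t * v' t := by rw [h3, h4]⟩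
  have hhN : h ∈ N := hN.2 ⟨hh, by rw [heq, laurent_star_laurent hu.2]; exact hg⟩
  obtain ⟨k, hk, rfl⟩ : h ∈ mulH2 w := hNw ▸ hhN
  refine ⟨star c • k, H2.smul_mem _ hk, ?_⟩
  change laurent w k = _
  apply Lp.ext
  filter_upwards [laurent_coeFn w k, laurent_coeFn u (star c • k), Lp.coeFn_smul (star c) k, hfu',
    hu'f, hu'c] with t h1 h2 h3 h4 h5 h6
  have h7 : c * star c = 1 := by rw [RCLike.star_def, RCLike.mul_conj, hc]; simp
  rw [h1, h2, h3, h4, ← h5, h6, Pi.smul_apply, smul_eq_mul]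
  linear_combination (-(w t * k t)) * h7

/-! ### The model space and its orthogonal complement -/

theorem laurent_mem_mulH2_orthogonal {θ : Linf} (hθ : ∀ᵐ t ∂m, ‖θ t‖ = 1) {c : L2}
    (hc : c ∈ H2ᗮ) : laurent θ c ∈ (mulH2 θ)ᗮ := by
  rw [Submodule.mem_orthogonal]
  rintro _ ⟨h, hh, rfl⟩
  change inner ℂ (laurent θ h) (laurent θ c) = 0
  rw [inner_laurent_left, laurent_star_laurent hθ]
  exact Submodule.inner_right_of_mem_orthogonal hh hc

theorem laurent_star_mem_of_mem_mulH2_orthogonal {θ : Linf} {f : L2} (hf : f ∈ (mulH2 θ)ᗮ) :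
    laurent (star θ) f ∈ H2ᗮ := by
  rw [Submodule.mem_orthogonal]
  intro h hh
  rw [inner_laurent_right, star_star]
  exact Submodule.inner_right_of_mem_orthogonal (K := mulH2 θ) ⟨h, hh, rfl⟩ hf

theorem laurent_mem_modelSpace_orthogonal (θ : Linf) {a : L2} (ha : a ∈ H2) :
    laurent θ a ∈ (modelSpace θ)ᗮ :=
  (Submodule.mem_orthogonal' _ _).2 fun _ hy =>
    Submodule.inner_right_of_mem_orthogonal (K := mulH2 θ) ⟨a, ha, rfl⟩ hy.2

theorem mem_modelSpace_orthogonal_of_mem (θ : Linf) {b : L2} (hb : b ∈ H2ᗮ) :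
    b ∈ (modelSpace θ)ᗮ :=
  Submodule.orthogonal_le inf_le_left hb

/-- `K_θ^⊥ = θ H² ⊕ (H²)^⊥`. -/
theorem exists_add_of_mem_modelSpace_orthogonal {θ : Linf} (hθ : IsInner θ) {f : L2}
    (hf : f ∈ (modelSpace θ)ᗮ) : ∃ a ∈ H2, ∃ b ∈ H2ᗮ, f = laurent θ a + b := by
  obtain ⟨g, hg, b, hb, rfl⟩ := exists_add_of_H2 f
  obtain ⟨a, ha, c, hc, hac⟩ := exists_add_of_H2 (laurent (star θ) g)
  have hgac : g = laurent θ a + laurent θ c := by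
    rw [← map_add, ← hac, laurent_laurent_star hθ.2]
  have hK : laurent θ c ∈ modelSpace θ := by
    refine ⟨?_, laurent_mem_mulH2_orthogonal hθ.2 hc⟩
    rw [← sub_eq_of_eq_add' hgac]
    exact H2.sub_mem hg (hθ.laurent_mem_H2 ha)
  have hKo : laurent θ c ∈ (modelSpace θ)ᗮ := by
    rw [← sub_eq_of_eq_add' hgac]
    refine Submodule.sub_mem _ ?_ (laurent_mem_modelSpace_orthogonal θ ha)
    have := Submodule.sub_mem _ hf (mem_modelSpace_orthogonal_of_mem θ hb)
    rwa [add_sub_cancel_right] at this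
  rw [eq_zero_of_mem_of_mem_orthogonal hK hKo, add_zero] at hgac
  exact ⟨a, ha, b, hb, by rw [hgac]⟩

theorem norm_dualTruncatedToeplitz_eq_iff {θ φ : Linf} (hφ : ∀ᵐ t ∂m, ‖φ t‖ = 1)
    (x : (modelSpace θ)ᗮ) :
    ‖dualTruncatedToeplitz θ φ x‖ = ‖x‖ ↔ laurent φ x ∈ (modelSpace θ)ᗮ := by
  rw [Submodule.mem_iff_norm_starProjection, norm_laurent hφ]; rfl

theorem norm_truncatedToeplitz_eq_iff {θ φ : Linf} (hφ : ∀ᵐ t ∂m, ‖φ t‖ = 1)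
    (x : modelSpace θ) :
    ‖truncatedToeplitz θ φ x‖ = ‖x‖ ↔ laurent φ x ∈ modelSpace θ := by
  rw [Submodule.mem_iff_norm_starProjection, norm_laurent hφ]; rfl

theorem truncatedToeplitz_eq_zero_iff {θ φ : Linf} (x : modelSpace θ) :
    truncatedToeplitz θ φ x = 0 ↔ laurent φ x ∈ (modelSpace θ)ᗮ := by
  change (modelSpace θ).orthogonalProjectionOnto (laurent φ x) = 0 ↔ _
  rw [Submodule.orthogonalProjectionOnto_eq_zero_iff]

/-! ### Partial isometries -/

theorem IsPartialIsometry.exists_norm_eq {H : Type*} [NormedAddCommGroup H]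
    [InnerProductSpace ℂ H] [CompleteSpace H] {T : H →L[ℂ] H} (hT : IsPartialIsometry T)
    (hne : T ≠ 0) : ∃ h, h ≠ 0 ∧ ‖T h‖ = ‖h‖ := by
  have : CompleteSpace (LinearMap.ker T.toLinearMap) := T.isClosed_ker.completeSpace_coe
  have hbot : (LinearMap.ker T.toLinearMap)ᗮ ≠ ⊥ := fun h => hne <| by
    rw [Submodule.orthogonal_eq_bot_iff, LinearMap.ker_eq_top] at h
    exact ContinuousLinearMap.coe_injective h
  obtain ⟨h, hh, h0⟩ := Submodule.exists_mem_ne_zero_of_ne_bot hbot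
  exact ⟨h, h0, hT h hh⟩

/-- If `A_φ` is a partial isometry and `φ` is unimodular, then `A_φ` annihilates the component in
`K_θ` of `φ̄ x` for every `x ∈ K_θ^⊥`: that component is orthogonal to the initial space, because
`φ` maps the initial space into `K_θ`. -/
theorem laurent_mem_orthogonal_of_isPartialIsometry {θ φ : Linf} (hφ : ∀ᵐ t ∂m, ‖φ t‖ = 1)
    (hpi : IsPartialIsometry (truncatedToeplitz θ φ)) {x y : L2} (hx : x ∈ (modelSpace θ)ᗮ)
    (hy : y ∈ modelSpace θ) (hxy : laurent (star φ) x - y ∈ (modelSpace θ)ᗮ) :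
    laurent φ y ∈ (modelSpace θ)ᗮ := by
  set T := truncatedToeplitz θ φ with hT
  have : CompleteSpace (LinearMap.ker T.toLinearMap) := T.isClosed_ker.completeSpace_coe
  have hker : (⟨y, hy⟩ : modelSpace θ) ∈ LinearMap.ker T.toLinearMap := by
    rw [← Submodule.orthogonal_orthogonal (LinearMap.ker T.toLinearMap), Submodule.mem_orthogonal]
    intro g hg
    have h1 : laurent φ g ∈ modelSpace θ := (norm_truncatedToeplitz_eq_iff hφ g).1 (hpi g hg)
    have h2 : inner ℂ (g : L2) (laurent (star φ) x) = 0 := by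
      rw [inner_laurent_right, star_star]
      exact Submodule.inner_right_of_mem_orthogonal h1 hx
    have h3 := Submodule.inner_right_of_mem_orthogonal g.2 hxy
    rw [inner_sub_right, h2, zero_sub, neg_eq_zero] at h3
    exact h3
  exact (truncatedToeplitz_eq_zero_iff ⟨y, hy⟩).1 hker

/-! ### Products of Toeplitz operators with inner symbols -/

theorem IsInner.isUnimodularConst {u : Linf} (hu : IsInner u)
    (h : ∀ n : ℤ, 0 < n → coeff n (laurent u one2) = 0) : IsUnimodularConst u := by
  set c := coeff 0 (laurent u one2) with hc
  have h1 : laurent u one2 - c • one2 = 0 := by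
    refine eq_zero_of_coeff_eq_zero fun n => ?_
    rw [map_sub, map_smul, one2, coeff_fourierLp, ← one2, smul_eq_mul]
    rcases lt_trichotomy n 0 with hn | rfl | hn
    · rw [mem_H2_iff.1 (hu.laurent_mem_H2 one2_mem_H2) n hn, if_neg hn.ne, mul_zero, sub_zero]
    · rw [if_pos rfl, ← hc, mul_one, sub_self]
    · rw [h n hn, if_neg hn.ne', mul_zero, sub_zero]
  have h2 : ∀ᵐ t ∂m, u t = c := by
    filter_upwards [laurent_one2_coeFn u, Lp.coeFn_smul c one2, one2_coeFn] with t h3 h4 h5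
    rw [← h3, sub_eq_zero.1 h1, h4, Pi.smul_apply, h5, smul_eq_mul, mul_one]
  obtain ⟨t, h3, h4⟩ := (h2.and hu.2).exists
  exact ⟨c, h3 ▸ h4, h2⟩

theorem coeff_neg_one_laurent_star (v : Linf) (n : ℤ) :
    coeff (-1) (laurent (star v) (fourierLp 2 (n - 1))) = star (coeff n (laurent v one2)) := by
  have h1 : (fourierLp 2 (-1) : L2) = laurent (fourierLp ∞ (-1)) one2 := by
    rw [one2, laurent_fourierLp, add_zero]
  rw [coeff_eq_inner, inner_laurent_right, star_star, h1, laurent_comm, inner_laurent_left,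
    star_fourierLp, laurent_fourierLp, coeff_eq_inner, RCLike.star_def, inner_conj_symm]
  congr 2
  ring

/-- A case of the Brown–Halmos theorem. If the product of the Toeplitz operators with symbols
`u` and `v̄` is the Toeplitz operator with symbol `u v̄`, that is, if `u P₋(v̄ h) ⊥ H²` for all
`h ∈ H²`, then `u` or `v` is constant. -/
theorem isUnimodularConst_or_of_forall {u v : Linf} (hu : IsInner u) (hv : IsInner v)
    (H : ∀ h ∈ H2, ∃ g ∈ H2, ∃ q ∈ H2ᗮ, laurent (star v) h = g + q ∧ laurent u q ∈ H2ᗮ) :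
    IsUnimodularConst u ∨ IsUnimodularConst v := by
  by_contra! hcon
  obtain ⟨n, hn, hne⟩ : ∃ n : ℤ, 0 < n ∧ coeff n (laurent u one2) ≠ 0 := by
    by_contra! h
    exact hcon.1 (hu.isUnimodularConst h)
  have key : ∀ h ∈ H2, coeff (-1) (laurent (star v) h) = 0 := by
    intro h hh
    obtain ⟨g, hg, q, hq, hgq, huq⟩ := H h hh
    obtain ⟨g', hg', q', hq', hgq', huq'⟩ := H _ (laurent_z_mem_H2 hh)
    rw [mem_H2_orthogonal_iff] at hq hq' huq huq'
    -- `z P₋(v̄ h)` and `P₋(z v̄ h)` differ by the constant `α`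
    set α := coeff (-1) q with hα
    have hd : laurent z q - q' = g' - laurent z g := by
      rw [laurent_comm, hgq, map_add] at hgq'
      rw [sub_eq_sub_iff_add_eq_add, add_comm, hgq']
    have hconst : laurent z q - q' = α • one2 := by
      rw [← sub_eq_zero]
      refine eq_zero_of_coeff_eq_zero fun k => ?_
      rw [map_sub, map_smul, one2, coeff_fourierLp, smul_eq_mul]
      rcases lt_trichotomy k 0 with hk | rfl | hk
      · rw [hd, mem_H2_iff.1 (H2.sub_mem hg' (laurent_z_mem_H2 hg)) k hk, if_neg hk.ne, mul_zero,
          sub_zero]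
      · rw [map_sub, coeff_laurent_z, hq' 0 le_rfl, if_pos rfl, zero_sub, ← hα]
        ring
      · rw [map_sub, coeff_laurent_z, hq _ (by omega), hq' _ hk.le, if_neg hk.ne']
        ring
    have hz : α * coeff n (laurent u one2) = 0 := by
      rw [← smul_eq_mul, ← map_smul, ← map_smul, ← hconst, map_sub, map_sub, laurent_comm,
        coeff_laurent_z, huq _ (by omega), huq' _ hn.le, sub_zero]
    rw [hgq, map_add, mem_H2_iff.1 hg _ (by omega), ← hα, (mul_eq_zero.1 hz).resolve_right hne,
      add_zero]
  refine hcon.2 (hv.isUnimodularConst fun k hk => ?_)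
  rw [← star_eq_zero, ← coeff_neg_one_laurent_star]
  exact key _ (fourierLp_mem_H2 (by omega))

/-! ### Extremal vectors of the dual truncated Toeplitz operator -/

theorem laurent_eq_of_ae_eq_mul {θ v w : Linf} (h : ∀ᵐ t ∂m, θ t = v t * w t) (f : L2) :
    laurent θ f = laurent v (laurent w f) := by
  apply Lp.ext
  filter_upwards [h, laurent_coeFn θ f, laurent_coeFn v (laurent w f), laurent_coeFn w f]
    with t h1 h2 h3 h4
  rw [h2, h3, h4, h1, mul_assoc]

theorem InnerCoprime.symm {u v : Linf} (h : InnerCoprime u v) : InnerCoprime v u :=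
  fun w hw hv hu => h w hw hu hv

/-- If `A_{ūv}` is a nonzero partial isometry, then the Toeplitz operator with symbol `θ̄ u` has a
nonzero kernel: an extremal vector of `A_{ūv}` is divisible by `u`. -/
theorem exists_laurent_star_mem_orthogonal {θ u v : Linf} (hu : IsInner u) (hv : IsInner v)
    (hne : truncatedToeplitz θ (conjMul u v) ≠ 0)
    (hpi : IsPartialIsometry (truncatedToeplitz θ (conjMul u v))) (hgcd : InnerCoprime u v) :
    ∃ f ∈ H2, f ≠ 0 ∧ laurent (star θ) (laurent u f) ∈ H2ᗮ := by
  obtain ⟨⟨x, hx⟩, hx0, hnorm⟩ := hpi.exists_norm_eq hne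
  have hg : laurent (conjMul u v) x ∈ modelSpace θ :=
    (norm_truncatedToeplitz_eq_iff (norm_conjMul hu.2 hv.2) ⟨x, hx⟩).1 hnorm
  obtain ⟨f, hf, rfl⟩ := hgcd.mem_mulH2 hu hv hx.1 hg.1
    (by rw [laurent_conjMul, laurent_laurent_star hu.2])
  refine ⟨f, hf, ?_, laurent_star_mem_of_mem_mulH2_orthogonal hx.2⟩
  rintro rfl
  exact hx0 (Subtype.ext (map_zero _))

/-- Extremal vectors of `D_{ūv}` in `θ H²` lie in `θ u H²`. If `ū v θ h = θ a + b`, then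
`k = v h - u a` satisfies `ū θ k = b ⊥ H²`; Coburn's lemma gives `k = 0`, and `u` divides `h` by
coprimality. -/
theorem exists_eq_laurent_of_laurent_conjMul_mem {θ u v : Linf} (hθ : IsInner θ) (hu : IsInner u)
    (hv : IsInner v) (hne : truncatedToeplitz θ (conjMul u v) ≠ 0)
    (hpi : IsPartialIsometry (truncatedToeplitz θ (conjMul u v))) (hgcd : InnerCoprime u v)
    {h : L2} (hh : h ∈ H2)
    (hmem : laurent (conjMul u v) (laurent θ h) ∈ (modelSpace θ)ᗮ) :
    ∃ k ∈ H2, h = laurent u k := by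
  obtain ⟨f, hf, hf0, hθuf⟩ := exists_laurent_star_mem_orthogonal hu hv hne hpi hgcd
  obtain ⟨a, ha, b, hb, hab⟩ := exists_add_of_mem_modelSpace_orthogonal hθ hmem
  -- `k = v h - u a` lies in the kernel of the Toeplitz operator with symbol `ū θ`
  have hk : laurent v h - laurent u a ∈ H2 :=
    H2.sub_mem (hv.laurent_mem_H2 hh) (hu.laurent_mem_H2 ha)
  have hσk : laurent (conjMul u θ) (laurent v h - laurent u a) = b := by
    rw [map_sub, laurent_conjMul, laurent_conjMul, laurent_comm θ u, laurent_star_laurent hu.2,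
      laurent_comm θ v, ← laurent_conjMul, hab, add_sub_cancel_left]
  have hσf : laurent (star (conjMul u θ)) f ∈ H2ᗮ := by
    rwa [laurent_star_conjMul, laurent_comm]
  have hk0 := (coburn (norm_conjMul hu.2 hθ.2) hk hf (hσk ▸ hb) hσf).resolve_right hf0
  exact hgcd.mem_mulH2 hu hv hh ha (sub_eq_zero.1 hk0)

/-- Extremal vectors of `D_{ūv}` in `(H²)^⊥` are conjugates of functions in `z v H²`. The role
of Coburn's lemma is played by the fact that `θ v̄` is inner. -/
theorem exists_eq_star_of_laurent_conjMul_mem {θ u v : Linf} (hθ : IsInner θ) (hu : IsInner u)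
    (hv : IsInner v) (hgcd : InnerCoprime u v) (hdvd : InnerDvd v θ) {f : L2} (hf : f ∈ H2ᗮ)
    (hmem : laurent (conjMul u v) f ∈ (modelSpace θ)ᗮ) :
    ∃ h ∈ H2, f = star (laurent z (laurent v h)) := by
  obtain ⟨w, hw, hvw⟩ := hdvd
  obtain ⟨h, hh, rfl⟩ := mem_H2_orthogonal_iff_exists.1 hf
  obtain ⟨a, ha, b, hb, hab⟩ := exists_add_of_mem_modelSpace_orthogonal hθ hmem
  obtain ⟨b, hb', rfl⟩ := mem_H2_orthogonal_iff_exists.1 hb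
  have hk : laurent u h - laurent v b ∈ H2 :=
    H2.sub_mem (hu.laurent_mem_H2 hh) (hv.laurent_mem_H2 hb')
  -- conjugate the identity `ū v f = θ a + b`, and multiply it by `z̄ θ`
  have hconj : laurent w (laurent u h - laurent v b) = star (laurent z a) := by
    have h1 := congrArg (fun x => laurent (star z) (laurent θ (star x))) hab
    simp only [star_add_L2, star_star, star_laurent, map_add, laurent_star_conjMul,
      laurent_laurent_star hθ.2] at h1
    rw [laurent_comm (star v) z, laurent_comm u z, laurent_comm θ z, laurent_comm θ z,
      laurent_star_laurent norm_z, laurent_star_laurent norm_z, laurent_comm u (star v),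
      laurent_eq_of_ae_eq_mul hvw, laurent_comm w (star v), laurent_laurent_star hv.2,
      laurent_eq_of_ae_eq_mul hvw b, laurent_comm v w] at h1
    rw [map_sub, h1, star_laurent, add_sub_cancel_right]
  have hk0 : laurent w (laurent u h - laurent v b) = 0 :=
    eq_zero_of_mem_of_mem_orthogonal (hw.laurent_mem_H2 hk)
      (hconj ▸ mem_H2_orthogonal_iff_exists.2 ⟨a, ha, rfl⟩)
  have huh : laurent u h = laurent v b :=
    sub_eq_zero.1 (laurent_injective hw.2 (hk0.trans (map_zero _).symm))
  obtain ⟨k, hk', rfl⟩ := hgcd.symm.mem_mulH2 hv hu hh hb' huh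
  exact ⟨k, hk', rfl⟩

/-- The hypotheses on `A_{ūv}` already force one of `u` and `v` to be constant. For `h ∈ H²` write
`v̄ u h = p + q` with `p ∈ H²` and `q ⊥ H²`. As `A_{ūv}` is a partial isometry, `ū v` maps `θ p`
into `K_θ^⊥`, so `p ∈ u H²`, and the theorem of Brown and Halmos applies. -/
theorem isUnimodularConst_or_of_isPartialIsometry {θ u v : Linf} (hθ : IsInner θ) (hu : IsInner u)
    (hv : IsInner v) (hne : truncatedToeplitz θ (conjMul u v) ≠ 0)
    (hpi : IsPartialIsometry (truncatedToeplitz θ (conjMul u v))) (hgcd : InnerCoprime u v)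
    (hdvd : InnerDvd v θ) : IsUnimodularConst u ∨ IsUnimodularConst v := by
  obtain ⟨w, hw, hvw⟩ := hdvd
  have hφ := norm_conjMul hu.2 hv.2
  refine isUnimodularConst_or_of_forall hu hv fun h hh => ?_
  obtain ⟨p, hp, q, hq, hpq⟩ := exists_add_of_H2 (laurent (star v) (laurent u h))
  have hx := laurent_mem_modelSpace_orthogonal θ hh
  have hφx : laurent (star (conjMul u v)) (laurent θ h) = laurent w (laurent u h) := by
    rw [laurent_star_conjMul, laurent_eq_of_ae_eq_mul hvw, laurent_star_laurent hv.2,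
      laurent_comm]
  have hsum : laurent w (laurent u h) = laurent θ p + laurent θ q := by
    rw [← map_add, ← hpq, laurent_eq_of_ae_eq_mul hvw, laurent_comm w (star v),
      laurent_laurent_star hv.2]
  have hy : laurent θ q ∈ modelSpace θ := by
    refine ⟨?_, laurent_mem_mulH2_orthogonal hθ.2 hq⟩
    rw [← sub_eq_of_eq_add' hsum]
    exact H2.sub_mem (hw.laurent_mem_H2 (hu.laurent_mem_H2 hh)) (hθ.laurent_mem_H2 hp)
  have hθp := laurent_mem_modelSpace_orthogonal θ hp
  have hφy := laurent_mem_orthogonal_of_isPartialIsometry hφ hpi hx hy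
    (by rwa [hφx, hsum, add_sub_cancel_right])
  have hφp : laurent (conjMul u v) (laurent θ p) ∈ (modelSpace θ)ᗮ := by
    have h1 := congrArg (laurent (conjMul u v)) (hφx.trans hsum)
    rw [laurent_laurent_star hφ, map_add] at h1
    rw [eq_sub_of_add_eq h1.symm]
    exact Submodule.sub_mem _ hx hφy
  obtain ⟨g, hg, rfl⟩ :=
    exists_eq_laurent_of_laurent_conjMul_mem hθ hu hv hne hpi hgcd hp hφp
  refine ⟨g, hg, laurent (star u) q, hu.laurent_star_mem_orthogonal hq, ?_, ?_⟩
  · apply laurent_injective hu.2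
    rw [map_add, laurent_laurent_star hu.2, ← hpq, laurent_comm]
  · rwa [laurent_laurent_star hu.2]

theorem image_extremalPlus {θ u v : Linf} (hθ : IsInner θ) (hu : IsInner u)
    (hv : IsInner v) (hne : truncatedToeplitz θ (conjMul u v) ≠ 0)
    (hpi : IsPartialIsometry (truncatedToeplitz θ (conjMul u v))) (hgcd : InnerCoprime u v) :
    Subtype.val '' extremalPlus θ (conjMul u v) =
      {f : L2 | ∃ h ∈ H2, f = laurent θ (laurent u h)} := by
  have hφ := norm_conjMul hu.2 hv.2
  ext f
  constructor
  · rintro ⟨x, ⟨⟨h, hh, hx⟩, hxe⟩, rfl⟩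
    change laurent θ h = x at hx
    rw [norm_dualTruncatedToeplitz_eq_iff hφ, ← hx] at hxe
    obtain ⟨k, hk, rfl⟩ := exists_eq_laurent_of_laurent_conjMul_mem hθ hu hv hne hpi hgcd hh hxe
    exact ⟨k, hk, hx.symm⟩
  · rintro ⟨h, hh, rfl⟩
    have huh := hu.laurent_mem_H2 hh
    refine ⟨⟨_, laurent_mem_modelSpace_orthogonal θ huh⟩, ⟨⟨_, huh, rfl⟩, ?_⟩, rfl⟩
    rw [norm_dualTruncatedToeplitz_eq_iff hφ]
    change laurent (conjMul u v) (laurent θ (laurent u h)) ∈ _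
    rw [laurent_conjMul, laurent_comm θ u, laurent_comm v u,
      laurent_star_laurent hu.2, laurent_comm v θ]
    exact laurent_mem_modelSpace_orthogonal θ (hv.laurent_mem_H2 hh)

theorem image_extremalMinus {θ u v : Linf} (hθ : IsInner θ) (hu : IsInner u) (hv : IsInner v)
    (hgcd : InnerCoprime u v) (hdvd : InnerDvd v θ) :
    Subtype.val '' extremalMinus θ (conjMul u v) =
      {f : L2 | ∃ h ∈ H2, f = star (laurent z (laurent v h))} := by
  have hφ := norm_conjMul hu.2 hv.2
  ext f
  constructor
  · rintro ⟨x, ⟨hx, hxe⟩, rfl⟩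
    rw [norm_dualTruncatedToeplitz_eq_iff hφ] at hxe
    exact exists_eq_star_of_laurent_conjMul_mem hθ hu hv hgcd hdvd hx hxe
  · rintro ⟨h, hh, rfl⟩
    have hmem : star (laurent z (laurent v h)) ∈ H2ᗮ :=
      mem_H2_orthogonal_iff_exists.2 ⟨_, hv.laurent_mem_H2 hh, rfl⟩
    refine ⟨⟨_, mem_modelSpace_orthogonal_of_mem θ hmem⟩, ⟨hmem, ?_⟩, rfl⟩
    rw [norm_dualTruncatedToeplitz_eq_iff hφ]
    refine mem_modelSpace_orthogonal_of_mem θ (mem_H2_orthogonal_iff_exists.2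
      ⟨_, hu.laurent_mem_H2 hh, ?_⟩)
    change laurent (conjMul u v) (star (laurent z (laurent v h))) = _
    rw [laurent_conjMul, laurent_comm z v, star_laurent v, laurent_laurent_star hv.2,
      laurent_comm z u, star_laurent u]

theorem norm_dualTruncatedToeplitz {θ u v : Linf} (hθ : IsInner θ) (hu : IsInner u)
    (hv : IsInner v) : ‖dualTruncatedToeplitz θ (conjMul u v)‖ = 1 := by
  have hφ := norm_conjMul hu.2 hv.2
  apply le_antisymm
  · refine ContinuousLinearMap.opNorm_le_bound _ zero_le_one fun x => ?_
    rw [one_mul]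
    exact ((modelSpace θ)ᗮ.norm_orthogonalProjectionOnto_apply_le _).trans
      (norm_laurent hφ _).le
  · -- the norm is attained at `θ u`
    have hu1 := hu.laurent_mem_H2 one2_mem_H2
    let x : (modelSpace θ)ᗮ := ⟨_, laurent_mem_modelSpace_orthogonal θ hu1⟩
    have hx : ‖dualTruncatedToeplitz θ (conjMul u v) x‖ = ‖x‖ := by
      rw [norm_dualTruncatedToeplitz_eq_iff hφ]
      change laurent (conjMul u v) (laurent θ (laurent u one2)) ∈ _
      rw [laurent_conjMul, laurent_comm θ u, laurent_comm v u,
        laurent_star_laurent hu.2, laurent_comm v θ]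
      exact laurent_mem_modelSpace_orthogonal θ (hv.laurent_mem_H2 one2_mem_H2)
    have hx0 : 0 < ‖x‖ := by
      change 0 < ‖laurent θ (laurent u one2)‖
      rw [norm_laurent hθ.2, norm_laurent hu.2, norm_pos_iff]
      exact one2_ne_zero
    have := (dualTruncatedToeplitz θ (conjMul u v)).le_opNorm x
    rw [hx] at this
    exact le_of_mul_le_mul_right (by rwa [one_mul]) hx0

/-- If `u` or `v` is constant, then `ū v` maps `θ H²` or `(H²)^⊥` into `K_θ^⊥`, so the two
components of an extremal vector are extremal separately. -/
theorem extremalVectors_eq_add {θ u v : Linf} (hθ : IsInner θ) (hu : IsInner u) (hv : IsInner v)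
    (h : IsUnimodularConst u ∨ IsUnimodularConst v) :
    extremalVectors (dualTruncatedToeplitz θ (conjMul u v)) =
      extremalPlus θ (conjMul u v) + extremalMinus θ (conjMul u v) := by
  have hφ := norm_conjMul hu.2 hv.2
  ext x
  rw [extremalVectors, Set.mem_ofPred_eq, norm_dualTruncatedToeplitz hθ hu hv, one_mul,
    norm_dualTruncatedToeplitz_eq_iff hφ, Set.mem_add]
  constructor
  · intro hx
    obtain ⟨a, ha, b, hb, hab⟩ := exists_add_of_mem_modelSpace_orthogonal hθ x.2
    rw [hab, map_add] at hx
    have hboth : laurent (conjMul u v) (laurent θ a) ∈ (modelSpace θ)ᗮ ∧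
        laurent (conjMul u v) b ∈ (modelSpace θ)ᗮ := by
      rcases h with ⟨c, -, hc⟩ | ⟨c, -, hc⟩
      · have h1 : laurent (conjMul u v) (laurent θ a) ∈ (modelSpace θ)ᗮ := by
          rw [laurent_conjMul, laurent_star_congr_const hc, laurent_comm v θ]
          exact Submodule.smul_mem _ _
            (laurent_mem_modelSpace_orthogonal θ (hv.laurent_mem_H2 ha))
        exact ⟨h1, (Submodule.add_mem_iff_right _ h1).1 hx⟩
      · have h1 : laurent (conjMul u v) b ∈ (modelSpace θ)ᗮ := by
          rw [laurent_conjMul, laurent_congr_const hc]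
          exact mem_modelSpace_orthogonal_of_mem θ
            (hu.laurent_star_mem_orthogonal (Submodule.smul_mem _ _ hb))
        exact ⟨(Submodule.add_mem_iff_left _ h1).1 hx, h1⟩
    refine ⟨⟨_, laurent_mem_modelSpace_orthogonal θ ha⟩, ⟨⟨a, ha, rfl⟩, ?_⟩,
      ⟨b, mem_modelSpace_orthogonal_of_mem θ hb⟩, ⟨hb, ?_⟩, Subtype.ext hab.symm⟩
    · exact (norm_dualTruncatedToeplitz_eq_iff hφ _).2 hboth.1
    · exact (norm_dualTruncatedToeplitz_eq_iff hφ _).2 hboth.2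
  · rintro ⟨y, ⟨-, hy⟩, y', ⟨-, hy'⟩, rfl⟩
    rw [norm_dualTruncatedToeplitz_eq_iff hφ] at hy hy'
    rw [Submodule.coe_add, map_add]
    exact Submodule.add_mem _ hy hy'

end TTO

end

theorem mainTheorem4 (θ u v : TTO.Linf)
    (hθ : TTO.IsInner θ) (hθc : ¬ TTO.IsConst θ) (hu : TTO.IsInner u) (hv : TTO.IsInner v)
    (hne : TTO.truncatedToeplitz θ (TTO.conjMul u v) ≠ 0)
    (hpi : TTO.IsPartialIsometry (TTO.truncatedToeplitz θ (TTO.conjMul u v)))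
    (hgcd : TTO.InnerCoprime u v) (hdvd : TTO.InnerDvd v θ) :
    -- `𝓔₊ = θ u H²`
    (Subtype.val '' TTO.extremalPlus θ (TTO.conjMul u v) =
      {f : TTO.L2 | ∃ h ∈ TTO.H2, f = TTO.laurent θ (TTO.laurent u h)}) ∧
    -- `𝓔₋` is the set of complex conjugates of the functions in `z v H²`
    (Subtype.val '' TTO.extremalMinus θ (TTO.conjMul u v) =
      {f : TTO.L2 | ∃ h ∈ TTO.H2, f = star (TTO.laurent TTO.z (TTO.laurent v h))}) ∧
    -- `𝓔_D = 𝓔₊ ⊕ 𝓔₋` if and only if `u` or `v` is a unimodular constant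
    (TTO.extremalVectors (TTO.dualTruncatedToeplitz θ (TTO.conjMul u v)) =
        TTO.extremalPlus θ (TTO.conjMul u v) + TTO.extremalMinus θ (TTO.conjMul u v) ↔
      TTO.IsUnimodularConst u ∨ TTO.IsUnimodularConst v) := by
  have h := TTO.isUnimodularConst_or_of_isPartialIsometry hθ hu hv hne hpi hgcd hdvd
  exact ⟨TTO.image_extremalPlus hθ hu hv hne hpi hgcd,
    TTO.image_extremalMinus hθ hu hv hgcd hdvd,
    fun _ => h, TTO.extremalVectors_eq_add hθ hu hv⟩
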